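/- Let $k$ be an algebraically closed field, let $A$ be a finite-dimensional unital associative $k$-algebra, and let $e_1,\dots,e_n\in A$ be a complete family of orthogonal idempotents. For a dimension vector $\underline d=(d_1,\dots,d_n)\in\mathbb{Z}_{\ge 0}^n$, let $\operatorname{rep}(A,\underline d)$ be the affine variety (with its Zariski topology) of all left $A$-module structures on $\bigoplus_i k^{d_i}$ in which $e_i$ acts as the projection onto $k^{d_i}$; the group $\operatorname{GL}(\underline d)=\prod_i\operatorname{GL}(d_i,k)$ acts on it by conjugation, and its orbits are the isomorphism classes of $A$-modules $M$ with $\dim_k e_iM=d_i$ for all $i$. (If $A$ is basic and the $e_i$ are primitive, then $n$ is the rank of $A$, and this is the usual variety of representations of dimension vector $\underline d$ of a bound quiver $(Q,I)$ with $A\simeq kQ/I$.) An irreducible component of $A$ is an irreducible component $\mathcal Z$ of $\operatorname{rep}(A,\underline d)$ for some $\underline d\neq 0$. The orbits of $X,Y\in\mathcal Z$ are orthogonal if $\operatorname{Hom}_A(X,Y)=\operatorname{Hom}_A(Y,X)=0$. A brick is a finitely generated left $A$-module $B$ with $\operatorname{End}_A(B)\simeq k$, and $A$ is brick-finite if it has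 only finitely many bricks up to isomorphism. Then: (a) If an irreducible component $\mathcal Z$ of $A$ has a dense orbit, i.e. $\mathcal Z=\overline{O_M}$ for some $M\in\mathcal Z$, then $\operatorname{Hom}_A(X,Y)\neq 0$ for all $X,Y\in\mathcal Z$. (b) The following are equivalent: (1) some irreducible component of $A$ contains a pair of orthogonal orbits; (2) there is an integer $m$ such that $A$ has infinitely many pairwise non-isomorphic bricks of $k$-dimension $m$. (c) If $A$ is brick-finite, then $\operatorname{Hom}_A(X,Y)\neq 0$ for every irreducible component $\mathcal Z$ of $A$ and all $X,Y\in\mathcal Z$. -/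

import Mathlib

universe u v

noncomputable section

/-- The graded vector space `⊕ᵢ k^{dᵢ}` of dimension vector `d`. -/
abbrev GradedSpace (k : Type u) [Field k] {n : ℕ} (d : Fin n → ℕ) : Type u :=
  (i : Fin n) → (Fin (d i) → k)

/-- The points of the representation variety `rep(A, d)` of a `k`-algebra `A`, relative to a
complete family `e` of orthogonal idempotents of `A`: the `A`-module structures on
`⊕ᵢ k^{dᵢ}` in which `eᵢ` acts as the projection onto the summand `k^{dᵢ}`, so that
`dim eᵢM = dᵢ`.
When `A` is basic and the `eᵢ` are primitive, `n` is the rank of `A`, and writing `A = kQ/I` with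
vertices `e₁, …, eₙ` such a structure is the same as a tuple of matrices `k^{dᵢ} → k^{dⱼ}`, one
for each arrow `i → j` of `Q`, satisfying the relations in `I`.  When `n = 1` and `e₁ = 1` it is
just an `A`-module structure on `k^{d₁}`. -/
@[ext]
structure RepVariety (k : Type u) [Field k] (A : Type v) [Ring A] [Algebra k A] {n : ℕ}
    (e : Fin n → A) (d : Fin n → ℕ) : Type (max u v) where
  /-- the action of `A` -/
  hom : A →ₐ[k] Module.End k (GradedSpace k d)
  hom_idem : ∀ i : Fin n, hom (e i) =
    LinearMap.single k (fun j : Fin n => Fin (d j) → k) i ∘ₗ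
      LinearMap.proj (φ := fun j : Fin n => Fin (d j) → k) i

namespace RepVariety

variable {k : Type u} [Field k] {A : Type v} [Ring A] [Algebra k A] {n : ℕ}
  {e : Fin n → A} {d : Fin n → ℕ}

/-- The affine coordinates of a point `x`: the entries, in the standard basis of `⊕ᵢ k^{dᵢ}`, of
the matrices by which the elements of `A` act. The triple `(a, p, q)` indexes the entry of the
matrix of `a` in row `q` and column `p`. -/
def coord (x : RepVariety k A e d)
    (c : A × (Σ i : Fin n, Fin (d i)) × (Σ i : Fin n, Fin (d i))) : k :=
  x.hom c.1 (Pi.single c.2.1.1 (Pi.single c.2.1.2 1)) c.2.2.1 c.2.2.2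

/-- The Zariski topology on `rep(A, d)`: its basic open sets are the non-vanishing loci of
polynomials in the coordinates. -/
instance zariski : TopologicalSpace (RepVariety k A e d) :=
  TopologicalSpace.generateFrom
    {U | ∃ p : MvPolynomial (A × (Σ i : Fin n, Fin (d i)) × (Σ i : Fin n, Fin (d i))) k,
      U = {x | MvPolynomial.eval x.coord p ≠ 0}}

/-- The orbit of `x` under the conjugation action of `GL(d) = ∏ᵢ GL(dᵢ, k)`. -/
def orbit (x : RepVariety k A e d) : Set (RepVariety k A e d) :=
  {y | ∃ g : (i : Fin n) → ((Fin (d i) → k) ≃ₗ[k] (Fin (d i) → k)),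
    ∀ a : A, y.hom a = (LinearEquiv.piCongrRight g).conj (x.hom a)}

/-- The left `A`-module given by a point `x` of `rep(A, d)`. -/
def Mod (_x : RepVariety k A e d) : Type u := GradedSpace k d

instance (x : RepVariety k A e d) : AddCommGroup x.Mod :=
  inferInstanceAs (AddCommGroup (GradedSpace k d))

instance (x : RepVariety k A e d) : Module A x.Mod :=
  Module.compHom (GradedSpace k d) (x.hom : A →+* Module.End k (GradedSpace k d))

/-- `X` and `Y` are Hom-orthogonal, i.e. their orbits are orthogonal:
`Hom_A(X, Y) = Hom_A(Y, X) = 0`. -/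
def HomOrthogonal (X Y : RepVariety k A e d) : Prop :=
  (∀ f : X.Mod →ₗ[A] Y.Mod, f = 0) ∧ (∀ f : Y.Mod →ₗ[A] X.Mod, f = 0)

/-- The subset `Z` of `rep(A, d)` has a dense orbit. -/
def HasDenseOrbit (Z : Set (RepVariety k A e d)) : Prop :=
  ∃ M ∈ Z, closure M.orbit = Z

end RepVariety

section Bricks

attribute [local instance] ModuleCat.moduleOfAlgebraModule ModuleCat.isScalarTower_of_algebra_moduleCat

/-- A brick: a finitely generated `A`-module with `End_A(M) ≃ k` as `k`-algebras. -/
def IsBrick (k : Type u) [Field k] (A : Type v) [Ring A] [Algebra k A]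
    (M : ModuleCat.{u} A) : Prop :=
  Module.Finite A M ∧ Nonempty (Module.End A M ≃ₐ[k] k)

/-- The set of isomorphism classes of bricks over `A`. -/
def brickClasses (k : Type u) [Field k] (A : Type v) [Ring A] [Algebra k A] :
    Set (Quotient (CategoryTheory.isIsomorphicSetoid (ModuleCat.{u} A))) :=
  {c | ∃ M : ModuleCat.{u} A, IsBrick k A M ∧ Quotient.mk _ M = c}

/-- The set of isomorphism classes of bricks over `A` of `k`-dimension `m`. -/
def brickClassesOfDim (k : Type u) [Field k] (A : Type v) [Ring A] [Algebra k A] (m : ℕ) :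
    Set (Quotient (CategoryTheory.isIsomorphicSetoid (ModuleCat.{u} A))) :=
  {c | ∃ M : ModuleCat.{u} A, IsBrick k A M ∧ Module.finrank k M = m ∧ Quotient.mk _ M = c}

/-- `A` is brick-finite: it has only finitely many bricks up to isomorphism. -/
def BrickFinite (k : Type u) [Field k] (A : Type v) [Ring A] [Algebra k A] : Prop :=
  (brickClasses k A).Finite

end Bricks

end

/-! `Hom_A(X, Y)` is the kernel of the commutator map, which depends regularly on each of `X` and
`Y`. Hence its vanishing is open in each variable separately, and its dimension is upper
semicontinuous.

(a) If `Hom(X, Y) = 0` on an orbit closure, moving `Y` and then `X` into the orbit gives isomorphic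
nonzero modules with no map between them.

(b) (1) ⇒ (2): every nonzero module has a brick that is both a submodule and a quotient
(`exists_isBrick_quotient_submodule`). If there are finitely many bricks in each dimension,
irreducibility makes one brick `J` play both roles on a dense subset of the component.
Semicontinuity improves dense to nonempty open, so suitable `X'`, `Y'` have a nonzero composite `X'
→ J → Y'`, against generic vanishing (`not_dense_quotient_submodule`).

(2) ⇒ (1): if no `Hom` vanishes on `Z` and `B ∈ Z` is a brick, then `dim Hom(B, Y) ≥ 1 = dim
End(B)`, so the identity deforms to an isomorphism `B → Y` for `Y` near `B`. Thus `Z` contains at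
most one brick up to isomorphism, and each dimension involves only finitely many components. A
single vanishing `Hom` yields an orthogonal pair by `exists_orthogonal`.

(c) follows from the argument for (1) ⇒ (2). -/

noncomputable section

set_option maxSynthPendingDepth 3

/-! ### Regular functions and the Zariski topology -/

namespace RepVariety

variable {k : Type u} [Field k] {A : Type v} [Ring A] [Algebra k A] {n : ℕ}
  {e : Fin n → A} {d : Fin n → ℕ}

/-- The algebra of regular functions on `rep(A, d)`. -/
def regularFunctions (k : Type u) [Field k] {A : Type v} [Ring A] [Algebra k A] {n : ℕ}
    (e : Fin n → A) (d : Fin n → ℕ) : Subalgebra k (RepVariety k A e d → k) :=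
  (MvPolynomial.aeval fun c (x : RepVariety k A e d) => x.coord c).range

theorem aeval_coord_apply
    (p : MvPolynomial (A × (Σ i : Fin n, Fin (d i)) × (Σ i : Fin n, Fin (d i))) k)
    (x : RepVariety k A e d) :
    MvPolynomial.aeval (fun c (y : RepVariety k A e d) => y.coord c) p x =
      MvPolynomial.eval x.coord p := by
  induction p using MvPolynomial.induction_on with
  | C a => simp
  | add p q hp hq => simp [hp, hq]
  | mul_X p i hp => simp [hp]

theorem isOpen_ne_zero {f : RepVariety k A e d → k} (hf : f ∈ regularFunctions k e d) :
    IsOpen {x | f x ≠ 0} := by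
  obtain ⟨p, rfl⟩ := hf
  refine TopologicalSpace.isOpen_generateFrom_of_mem ⟨p, ?_⟩
  ext x
  simp [aeval_coord_apply]

theorem coord_mem_regularFunctions
    (c : A × (Σ i : Fin n, Fin (d i)) × (Σ i : Fin n, Fin (d i))) :
    (fun x : RepVariety k A e d => x.coord c) ∈ regularFunctions k e d :=
  ⟨MvPolynomial.X c, by simp⟩

theorem regularFunctions_eq_adjoin :
    regularFunctions k e d =
      Algebra.adjoin k (Set.range fun c (x : RepVariety k A e d) => x.coord c) :=
  (Algebra.adjoin_range_eq_range_aeval k _).symm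

/-- Coordinates are indexed by all of `A` but are linear in the algebra element, so a basis of `A`
suffices. -/
theorem regularFunctions_fg [Module.Finite k A] : (regularFunctions k e d).FG := by
  let b := Module.finBasis k A
  let S : Set (RepVariety k A e d → k) := Set.range fun
    (c : Fin (Module.finrank k A) × (Σ i : Fin n, Fin (d i)) × (Σ i : Fin n, Fin (d i))) x =>
      x.coord (b c.1, c.2)
  have hS : S.Finite := Set.finite_range _
  refine Subalgebra.fg_def.2 ⟨S, hS, le_antisymm ?_ ?_⟩
  · rw [regularFunctions_eq_adjoin]
    apply Algebra.adjoin_mono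
    rintro _ ⟨c, rfl⟩
    exact ⟨(b c.1, c.2), rfl⟩
  · rw [regularFunctions_eq_adjoin, Algebra.adjoin_le_iff]
    rintro _ ⟨⟨a, c⟩, rfl⟩
    have : (fun x : RepVariety k A e d => x.coord (a, c)) =
        ∑ i, b.repr a i • fun x : RepVariety k A e d => x.coord (b i, c) := by
      ext x
      conv_lhs => rw [← b.sum_repr a]
      simp [coord, -Module.Basis.sum_repr, map_sum]
    simp only [this]
    exact Subalgebra.sum_mem _ fun i _ => Subalgebra.smul_mem (Algebra.adjoin k S)
      (Algebra.subset_adjoin (Set.mem_range.2 ⟨(i, c), rfl⟩)) _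

/-- The evaluation of regular functions at a point. -/
def evalRegular (x : RepVariety k A e d) : regularFunctions k e d →+* k :=
  (Pi.evalRingHom (fun _ : RepVariety k A e d => k) x).comp (regularFunctions k e d).val.toRingHom

/-- Basic open sets are pulled back from those of the spectrum, which is how Noetherianity reaches
`rep(A, d)`. -/
theorem isInducing_ker_evalRegular :
    Topology.IsInducing fun x : RepVariety k A e d =>
      (⟨RingHom.ker (evalRegular x), RingHom.ker_isPrime _⟩ :
        PrimeSpectrum (regularFunctions k e d)) := by
  constructor
  rw [PrimeSpectrum.isTopologicalBasis_basic_opens.eq_generateFrom, induced_generateFrom_eq]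
  unfold zariski
  congr 1
  ext U
  constructor
  · rintro ⟨p, rfl⟩
    refine ⟨_, ⟨⟨_, ⟨p, rfl⟩⟩, rfl⟩, ?_⟩
    exact Set.ext fun x => not_congr (Eq.congr_left (aeval_coord_apply p x))
  · rintro ⟨_, ⟨⟨_, ⟨p, rfl⟩⟩, rfl⟩, rfl⟩
    refine ⟨p, ?_⟩
    exact Set.ext fun x => not_congr (Eq.congr_left (aeval_coord_apply p x))

instance [Module.Finite k A] : TopologicalSpace.NoetherianSpace (RepVariety k A e d) := by
  have : Algebra.FiniteType k (regularFunctions k e d) :=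
    (Subalgebra.fg_iff_finiteType _).1 regularFunctions_fg
  have := Algebra.FiniteType.isNoetherianRing k (regularFunctions k e d)
  exact isInducing_ker_evalRegular.noetherianSpace

/-! ### Regular families of vectors and linear maps -/

section IsRegular

variable {E F : Type*} [AddCommGroup E] [Module k E] [AddCommGroup F] [Module k F]

/-- A map from `rep(A, d)` to a vector space is regular if so are its compositions with all
linear forms. -/
def IsRegular (s : RepVariety k A e d → E) : Prop :=
  ∀ l : Module.Dual k E, (fun x => l (s x)) ∈ regularFunctions k e d

namespace IsRegular

variable {s t : RepVariety k A e d → E}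

theorem const (c : E) : IsRegular fun _ : RepVariety k A e d => c := fun l =>
  Subalgebra.algebraMap_mem _ (l c)

theorem map (hs : IsRegular s) (f : E →ₗ[k] F) : IsRegular fun x => f (s x) :=
  fun l => hs (l ∘ₗ f)

theorem add (hs : IsRegular s) (ht : IsRegular t) : IsRegular fun x => s x + t x := fun l => by
  simp only [map_add]
  exact Subalgebra.add_mem _ (hs l) (ht l)

theorem sub (hs : IsRegular s) (ht : IsRegular t) : IsRegular fun x => s x - t x := fun l => by
  simp only [map_sub]
  exact Subalgebra.sub_mem _ (hs l) (ht l)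

theorem sum {ι : Type*} {I : Finset ι} {s : ι → RepVariety k A e d → E}
    (hs : ∀ i ∈ I, IsRegular (s i)) : IsRegular fun x => ∑ i ∈ I, s i x := fun l => by
  have := Subalgebra.sum_mem _ fun i hi => hs i hi l
  convert this using 1
  ext x
  simp

theorem smul_const {f : RepVariety k A e d → k} (hf : f ∈ regularFunctions k e d) (c : E) :
    IsRegular fun x => f x • c := fun l => by
  have := Subalgebra.smul_mem _ hf (l c)
  convert this using 1
  ext x
  simp [mul_comm]

theorem of_coord {ι : Type*} [Fintype ι] (b : Module.Basis ι k E)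
    (h : ∀ i, (fun x => b.coord i (s x)) ∈ regularFunctions k e d) : IsRegular s := by
  have : s = fun x => ∑ i, b.coord i (s x) • b i := by
    ext x
    exact (b.sum_repr (s x)).symm
  rw [this]
  exact sum fun i _ => smul_const (h i) _

theorem of_basis {ι : Type*} [Fintype ι] (b : Module.Basis ι k E)
    {s : RepVariety k A e d → E →ₗ[k] F} (h : ∀ i, IsRegular fun x => s x (b i)) :
    IsRegular s := by
  have : s = fun x => ∑ i, LinearMap.smulRightₗ (b.coord i) (s x (b i)) := by
    ext x v
    conv_lhs => rw [← b.sum_repr v]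
    simp [-Module.Basis.sum_repr, map_sum]
  rw [this]
  exact sum fun i _ => (h i).map _

theorem of_apply [Module.Finite k E] {s : RepVariety k A e d → E →ₗ[k] F}
    (h : ∀ v, IsRegular fun x => s x v) : IsRegular s :=
  of_basis (Module.finBasis k E) fun _ => h _

theorem hom_apply (a : A) : IsRegular fun x : RepVariety k A e d => x.hom a := by
  let b := Pi.basis fun i => Pi.basisFun k (Fin (d i))
  refine of_basis b fun p => of_coord b fun q => ?_
  convert coord_mem_regularFunctions (e := e) (a, p, q) using 2 with x
  obtain ⟨i, p⟩ := p
  obtain ⟨j, q⟩ := q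
  simp [b, coord]

theorem matrix_map {m : Type*} [Fintype m] [DecidableEq m] {M : RepVariety k A e d → Matrix m m k}
    (hM : ∀ i j, (fun x => M x i j) ∈ regularFunctions k e d) (x : RepVariety k A e d) :
    (evalRegular x).mapMatrix (Matrix.of fun i j => ⟨_, hM i j⟩) = M x := by
  ext
  rfl

theorem det {m : Type*} [Fintype m] [DecidableEq m] {M : RepVariety k A e d → Matrix m m k}
    (hM : ∀ i j, (fun x => M x i j) ∈ regularFunctions k e d) :
    (fun x => (M x).det) ∈ regularFunctions k e d := by
  convert ((Matrix.of fun i j => (⟨_, hM i j⟩ : regularFunctions k e d)).det).2 with x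
  rw [← matrix_map hM x, ← RingHom.map_det]
  rfl

theorem adjugate {m : Type*} [Fintype m] [DecidableEq m] {M : RepVariety k A e d → Matrix m m k}
    (hM : ∀ i j, (fun x => M x i j) ∈ regularFunctions k e d) (i j : m) :
    (fun x => (M x).adjugate i j) ∈ regularFunctions k e d := by
  convert ((Matrix.of fun i j => (⟨_, hM i j⟩ : regularFunctions k e d)).adjugate i j).2 with x
  rw [← matrix_map hM x, ← RingHom.map_adjugate]
  rfl

theorem linearMap_det [Module.Finite k E] {G : RepVariety k A e d → Module.End k E}
    (hG : IsRegular G) : (fun x => LinearMap.det (G x)) ∈ regularFunctions k e d := by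
  let b := Module.finBasis k E
  have := det (M := fun x => LinearMap.toMatrix b b (G x)) fun i j =>
    hG (LinearMap.proj j ∘ₗ LinearMap.proj i ∘ₗ (LinearMap.toMatrix b b).toLinearMap)
  simpa using this

/-- The adjugate is a polynomial substitute for the inverse, correct up to the factor `det`. -/
theorem exists_adjugate [Module.Finite k E] {G : RepVariety k A e d → Module.End k E}
    (hG : IsRegular G) : ∃ H : RepVariety k A e d → Module.End k E, IsRegular H ∧
      (∀ x, H x * G x = LinearMap.det (G x) • 1) ∧ ∀ x, G x = 1 → H x = 1 := by
  let b := Module.finBasis k E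
  let M := fun x => LinearMap.toMatrix b b (G x)
  refine ⟨fun x => Matrix.toLin b b (M x).adjugate, ?_, fun x => ?_, fun x hx => ?_⟩
  · refine of_basis b fun j => of_coord b fun i => ?_
    have := adjugate (M := M) (fun i j =>
      hG (LinearMap.proj j ∘ₗ LinearMap.proj i ∘ₗ (LinearMap.toMatrix b b).toLinearMap)) i j
    simpa [Matrix.toLin_self, Finsupp.single_apply] using this
  · have h : G x = Matrix.toLin b b (M x) := (Matrix.toLin_toMatrix b b _).symm
    conv_lhs => rw [h]
    rw [Module.End.mul_eq_comp, ← Matrix.toLin_mul, Matrix.adjugate_mul, map_smul,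
      Matrix.toLin_one, LinearMap.det_toMatrix]
    rfl
  · simp [M, hx]
    rfl

end IsRegular

end IsRegular

end RepVariety

/-! ### Kernels in regular families -/

namespace RepVariety

variable {k : Type u} [Field k] {A : Type v} [Ring A] [Algebra k A] {n : ℕ}
  {e : Fin n → A} {d : Fin n → ℕ}

section Families

variable {V W : Type*} [AddCommGroup V] [Module k V] [Module.Finite k V]
  [AddCommGroup W] [Module k W]

/-- Injectivity is an open condition in a regular family of linear maps. -/
theorem exists_isOpen_ker_eq_bot {Φ : RepVariety k A e d → V →ₗ[k] W} (hΦ : IsRegular Φ)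
    {x : RepVariety k A e d} (hx : LinearMap.ker (Φ x) = ⊥) :
    ∃ U, IsOpen U ∧ x ∈ U ∧ ∀ y ∈ U, LinearMap.ker (Φ y) = ⊥ := by
  -- With `s` fixed, `det (s ∘ Φ y)` is regular in `y`, equals 1 at `x`, and forces injectivity
  -- where it is nonzero.
  obtain ⟨s, hs⟩ := (Φ x).exists_leftInverse_of_injective hx
  refine ⟨_, isOpen_ne_zero (hΦ.map (LinearMap.llcomp k V W V s)).linearMap_det, ?_, ?_⟩
  · have : LinearMap.llcomp k V W V s (Φ x) = LinearMap.id := hs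
    simp [this]
  · intro y hy
    have h : LinearMap.ker (s ∘ₗ Φ y) = ⊥ :=
      not_not.1 fun h => hy (LinearMap.det_eq_zero_iff_ker_ne_bot.2 h)
    exact LinearMap.ker_eq_bot.2 (Function.Injective.of_comp (f := s) (LinearMap.ker_eq_bot.1 h))

/-- The dimension of the kernel is upper semicontinuous in a regular family of linear maps. -/
theorem exists_isOpen_finrank_ker_le {Φ : RepVariety k A e d → V →ₗ[k] W} (hΦ : IsRegular Φ)
    (x : RepVariety k A e d) :
    ∃ U, IsOpen U ∧ x ∈ U ∧ ∀ y ∈ U,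
      Module.finrank k (LinearMap.ker (Φ y)) ≤ Module.finrank k (LinearMap.ker (Φ x)) := by
  obtain ⟨P, hP⟩ := (LinearMap.ker (Φ x)).subtype.exists_leftInverse_of_injective
    (Submodule.ker_subtype _)
  -- The map `(Φ y, P)` is injective at `x`, hence nearby; there `P` embeds `ker (Φ y)` into `ker (Φ
  -- x)`.
  have hΨ : IsRegular fun y => LinearMap.inl k W _ ∘ₗ Φ y + LinearMap.inr k W _ ∘ₗ P :=
    (hΦ.map (LinearMap.llcomp k V W _ (LinearMap.inl k W (LinearMap.ker (Φ x))))).add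
      (IsRegular.const _)
  obtain ⟨U, hU, hxU, h⟩ := exists_isOpen_ker_eq_bot hΨ (x := x) (by
    rw [LinearMap.ker_eq_bot']
    intro v hv
    have h1 : Φ x v = 0 := by simpa using congrArg Prod.fst hv
    have h2 : P v = 0 := by simpa using congrArg Prod.snd hv
    have h3 := LinearMap.congr_fun hP ⟨v, h1⟩
    have h4 : P v = ⟨v, h1⟩ := h3
    exact congrArg Subtype.val (h4.symm.trans h2))
  refine ⟨U, hU, hxU, fun y hy => ?_⟩
  refine LinearMap.finrank_le_finrank_of_injective (f := P ∘ₗ (LinearMap.ker (Φ y)).subtype) ?_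
  rw [← LinearMap.ker_eq_bot, LinearMap.ker_eq_bot']
  rintro ⟨v, hv⟩ hv'
  have := LinearMap.ker_eq_bot'.1 (h y hy) v (by
    have h2 : P v = 0 := hv'
    simp [LinearMap.mem_ker.1 hv, h2])
  simpa using this

/-- Where the dimension of the kernel in a regular family of linear maps does not drop, a kernel
vector extends locally to a regular family of kernel vectors. -/
theorem exists_regular_section {Φ : RepVariety k A e d → V →ₗ[k] W} (hΦ : IsRegular Φ)
    {x : RepVariety k A e d} {f : V} (hf : Φ x f = 0) :
    ∃ (U : Set (RepVariety k A e d)) (s : RepVariety k A e d → V), IsOpen U ∧ x ∈ U ∧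
      IsRegular s ∧ s x = f ∧ ∀ y ∈ U,
        Module.finrank k (LinearMap.ker (Φ x)) ≤ Module.finrank k (LinearMap.ker (Φ y)) →
          Φ y (s y) = 0 := by
  set K := LinearMap.ker (Φ x) with hK
  obtain ⟨P, hP⟩ := K.subtype.exists_leftInverse_of_injective (Submodule.ker_subtype _)
  have hPK (v : K) : P v = v := LinearMap.congr_fun hP v
  obtain ⟨t, ht⟩ := (K.liftQ (Φ x) le_rfl).exists_leftInverse_of_injective
    (Submodule.ker_liftQ_eq_bot _ _ _ le_rfl)
  let r : (V ⧸ K) →ₗ[k] V := K.liftQ (LinearMap.id - K.subtype ∘ₗ P) fun v hv => by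
    simp [hPK ⟨v, hv⟩]
  have hr (v : V) : r (t (Φ x v)) = v - P v := by
    have : t (Φ x v) = K.mkQ v := LinearMap.congr_fun ht (K.mkQ v)
    rw [this]
    simp [r]
  -- `G` is the identity at `x` and agrees with `P` on `ker (Φ y)`. When the kernel does not shrink,
  -- `P` maps `ker (Φ y)` onto `K`, so `f = G y v` with `v ∈ ker (Φ y)`, and the adjugate sends `f`
  -- to a multiple of `v`.
  let G : RepVariety k A e d → Module.End k V := fun y =>
    K.subtype ∘ₗ P + LinearMap.llcomp k V W V (r ∘ₗ t) (Φ y)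
  have hG : IsRegular G := (IsRegular.const _).add (hΦ.map _)
  have hGx : G x = 1 := by
    ext v
    simp [G, hr]
  obtain ⟨H, hH, hHG, hH1⟩ := hG.exists_adjugate
  refine ⟨_, fun y => H y f, isOpen_ne_zero hG.linearMap_det, by simp [hGx],
    hH.map (LinearMap.applyₗ f), by simp [hH1 x hGx], fun y hy hle => ?_⟩
  have hHGv (v : V) : H y (G y v) = LinearMap.det (G y) • v := LinearMap.congr_fun (hHG y) v
  have hGker (v : V) (hv : Φ y v = 0) : G y v = P v := by simp [G, hv]
  let Q := P ∘ₗ (LinearMap.ker (Φ y)).subtype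
  have hQ : Function.Injective Q := by
    rw [← LinearMap.ker_eq_bot, LinearMap.ker_eq_bot']
    rintro ⟨v, hv⟩ hv'
    have h2 : P v = 0 := hv'
    have h3 := hHGv v
    rw [hGker v hv, h2, ZeroMemClass.coe_zero, map_zero, eq_comm, smul_eq_zero] at h3
    exact Subtype.ext (h3.resolve_left hy)
  have hQs : Function.Surjective Q := (LinearMap.injective_iff_surjective_of_finrank_eq_finrank
    (le_antisymm (LinearMap.finrank_le_finrank_of_injective hQ) hle)).1 hQ
  obtain ⟨⟨v, hv⟩, hvf⟩ := hQs ⟨f, hf⟩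
  have h4 : (P v : V) = f := congrArg Subtype.val hvf
  have h5 := hHGv v
  rw [hGker v hv, h4] at h5
  simp [h5, LinearMap.mem_ker.1 hv]

end Families

/-! ### Deforming intertwiners -/

section Intertwiners

variable {E F : Type*} [AddCommGroup E] [Module k E] [AddCommGroup F] [Module k F]

/-- The map sending `f` to the family of commutators `f ρ(a) - σ(a) f`. -/
def commutatorMap (ρ : A →ₐ[k] Module.End k E) (σ : A →ₐ[k] Module.End k F) :
    (E →ₗ[k] F) →ₗ[k] A →ₗ[k] (E →ₗ[k] F) :=
  LinearMap.mk₂ k (fun f a => f ∘ₗ ρ a - σ a ∘ₗ f)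
    (fun f g a => by ext; simp; abel)
    (fun c f a => by ext; simp [smul_sub])
    (fun f a b => by ext; simp; abel)
    (fun c f a => by ext; simp [smul_sub])

/-- The space of intertwiners between two representations of `A`. -/
def intertwiners (ρ : A →ₐ[k] Module.End k E) (σ : A →ₐ[k] Module.End k F) :
    Submodule k (E →ₗ[k] F) := LinearMap.ker (commutatorMap ρ σ)

theorem mem_intertwiners {ρ : A →ₐ[k] Module.End k E} {σ : A →ₐ[k] Module.End k F}
    {f : E →ₗ[k] F} : f ∈ intertwiners ρ σ ↔ ∀ a v, f (ρ a v) = σ a (f v) := by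
  simp [intertwiners, commutatorMap, LinearMap.ext_iff, sub_eq_zero]

theorem isRegular_commutatorMap_right [Module.Finite k A] [Module.Finite k E]
    (ρ : A →ₐ[k] Module.End k E) :
    IsRegular fun x : RepVariety k A e d => commutatorMap ρ x.hom := by
  refine IsRegular.of_apply fun f => IsRegular.of_apply fun a => ?_
  exact (IsRegular.const (f ∘ₗ ρ a)).sub
    ((IsRegular.hom_apply (k := k) (d := d) a).map (LinearMap.lcomp k _ f))

theorem isRegular_commutatorMap_left [Module.Finite k A] [Module.Finite k F]
    (σ : A →ₐ[k] Module.End k F) :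
    IsRegular fun x : RepVariety k A e d => commutatorMap x.hom σ := by
  refine IsRegular.of_apply fun f => IsRegular.of_apply fun a => ?_
  exact ((IsRegular.hom_apply (k := k) (d := d) a).map
    (LinearMap.llcomp k (GradedSpace k d) (GradedSpace k d) F f)).sub
    (IsRegular.const (σ a ∘ₗ f))

/-- If some intertwiner from `ρ` to `x` is injective, then there are injective intertwiners from
`ρ` to those points near `x` where the dimension of the space of intertwiners does not drop. -/
theorem exists_isOpen_injective_intertwiner [Module.Finite k A] [Module.Finite k E]
    {ρ : A →ₐ[k] Module.End k E} {x : RepVariety k A e d} {f : E →ₗ[k] GradedSpace k d}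
    (hf : f ∈ intertwiners ρ x.hom) (hinj : Function.Injective f) :
    ∃ U, IsOpen U ∧ x ∈ U ∧ ∀ y ∈ U,
      Module.finrank k (intertwiners ρ x.hom) ≤ Module.finrank k (intertwiners ρ y.hom) →
        ∃ g ∈ intertwiners ρ y.hom, Function.Injective g := by
  obtain ⟨U, s, hU, hxU, hs, hsx, h⟩ :=
    exists_regular_section (isRegular_commutatorMap_right ρ) hf
  obtain ⟨U', hU', hxU', h'⟩ := exists_isOpen_ker_eq_bot hs (x := x)
    (by rwa [hsx, LinearMap.ker_eq_bot])
  exact ⟨U ∩ U', hU.inter hU', ⟨hxU, hxU'⟩, fun y hy hle =>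
    ⟨s y, h y hy.1 hle, LinearMap.ker_eq_bot.1 (h' y hy.2)⟩⟩

/-- If some intertwiner from `x` to `σ` is surjective, then there are surjective intertwiners to
`σ` from those points near `x` where the dimension of the space of intertwiners does not drop. -/
theorem exists_isOpen_surjective_intertwiner [Module.Finite k A] [Module.Finite k F]
    {σ : A →ₐ[k] Module.End k F} {x : RepVariety k A e d} {f : GradedSpace k d →ₗ[k] F}
    (hf : f ∈ intertwiners x.hom σ) (hsurj : Function.Surjective f) :
    ∃ U, IsOpen U ∧ x ∈ U ∧ ∀ y ∈ U,
      Module.finrank k (intertwiners x.hom σ) ≤ Module.finrank k (intertwiners y.hom σ) →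
        ∃ g ∈ intertwiners y.hom σ, Function.Surjective g := by
  obtain ⟨U, s, hU, hxU, hs, hsx, h⟩ :=
    exists_regular_section (isRegular_commutatorMap_left σ) hf
  -- Surjectivity is open because it is injectivity of the transpose.
  obtain ⟨U', hU', hxU', h'⟩ := exists_isOpen_ker_eq_bot
    (hs.map (Module.Dual.transpose (R := k) (M := GradedSpace k d) (M' := F))) (x := x)
    (by rw [hsx, LinearMap.ker_eq_bot]
        exact LinearMap.dualMap_injective_of_surjective hsurj)
  exact ⟨U ∩ U', hU.inter hU', ⟨hxU, hxU'⟩, fun y hy hle =>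
    ⟨s y, h y hy.1 hle, LinearMap.dualMap_injective_iff.1 (LinearMap.ker_eq_bot.1 (h' y hy.2))⟩⟩

end Intertwiners

end RepVariety

/-! ### Modules as points of representation varieties -/

namespace RepVariety

variable {k : Type u} [Field k] {A : Type v} [Ring A] [Algebra k A] {n : ℕ}
  {e : Fin n → A} {d : Fin n → ℕ}

instance (x : RepVariety k A e d) : Module k x.Mod :=
  inferInstanceAs (Module k (GradedSpace k d))

instance (x : RepVariety k A e d) : IsScalarTower k A x.Mod :=
  ⟨fun c a v => LinearMap.congr_fun (map_smul x.hom c a) v⟩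

instance (x : RepVariety k A e d) : Module.Finite k x.Mod :=
  inferInstanceAs (Module.Finite k (GradedSpace k d))

section Modules

variable {M N : Type*} [AddCommGroup M] [Module k M] [Module A M] [IsScalarTower k A M]
  [AddCommGroup N] [Module k N] [Module A N] [IsScalarTower k A N]

/-- Homomorphisms of modules are the intertwiners of the corresponding representations. -/
def homEquivIntertwiners :
    (M →ₗ[A] N) ≃ intertwiners (Algebra.lsmul k k M : A →ₐ[k] _) (Algebra.lsmul k k N) where
  toFun f := ⟨f.restrictScalars k, mem_intertwiners.2 fun a v => f.map_smul a v⟩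
  invFun f := { f.1 with map_smul' := fun a v => mem_intertwiners.1 f.2 a v }
  left_inv _ := rfl
  right_inv _ := rfl

end Modules

theorem exists_ne_zero_iff_intertwiners_ne_bot (x y : RepVariety k A e d) :
    (∃ f : x.Mod →ₗ[A] y.Mod, f ≠ 0) ↔ intertwiners x.hom y.hom ≠ ⊥ := by
  rw [Submodule.ne_bot_iff]
  constructor
  · rintro ⟨f, hf⟩
    refine ⟨(homEquivIntertwiners (k := k) f).1, (homEquivIntertwiners (k := k) f).2,
      fun h => hf ?_⟩
    exact LinearMap.ext fun v => LinearMap.congr_fun h v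
  · rintro ⟨f, hf, hf0⟩
    refine ⟨(homEquivIntertwiners (k := k) (M := x.Mod) (N := y.Mod)).symm ⟨f, hf⟩,
      fun h => hf0 ?_⟩
    exact LinearMap.ext fun v => LinearMap.congr_fun h v

theorem homOrthogonal_iff (x y : RepVariety k A e d) :
    HomOrthogonal x y ↔ intertwiners x.hom y.hom = ⊥ ∧ intertwiners y.hom x.hom = ⊥ := by
  have h (x y : RepVariety k A e d) :
      (∀ f : x.Mod →ₗ[A] y.Mod, f = 0) ↔ intertwiners x.hom y.hom = ⊥ := by
    have := (exists_ne_zero_iff_intertwiners_ne_bot x y).not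
    push Not at this
    exact this
  exact and_congr (h x y) (h y x)

section Modules

variable {M : Type*} [AddCommGroup M] [Module k M] [Module A M] [IsScalarTower k A M]

/-- Every finite-dimensional module is isomorphic to a point of some representation variety. -/
theorem exists_point [Module.Finite k M] (he : CompleteOrthogonalIdempotents e) :
    ∃ (d : Fin n → ℕ) (x : RepVariety k A e d), Nonempty (M ≃ₗ[A] x.Mod) ∧
      ∑ i, d i = Module.finrank k M := by
  let P : Fin n → Module.End k M := fun i => Algebra.lsmul k k M (e i)
  let d : Fin n → ℕ := fun i => Module.finrank k (LinearMap.range (P i))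
  have hP (i j : Fin n) (m : M) : e i • e j • m = if i = j then e j • m else 0 := by
    rw [smul_smul, he.mul_eq]
    split_ifs with h
    · rw [h]
    · simp
  -- The Peirce decomposition `M = ⊕ᵢ eᵢM`; bases of the summands then give coordinates.
  let Φ₀ : M ≃ₗ[k] ((i : Fin n) → LinearMap.range (P i)) :=
    { LinearMap.pi fun i => (P i).rangeRestrict with
      invFun := fun w => ∑ i, (w i : M)
      left_inv := fun m => by
        change ∑ i, e i • m = m
        rw [← Finset.sum_smul, he.complete, one_smul]
      right_inv := fun w => by
        ext j
        change e j • ∑ i, (w i : M) = w j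
        rw [Finset.smul_sum, Finset.sum_eq_single j]
        · obtain ⟨m, hm⟩ := (w j).2
          rw [← hm]
          change e j • e j • m = e j • m
          simp [hP]
        · intro i _ hij
          obtain ⟨m, hm⟩ := (w i).2
          rw [← hm]
          change e j • e i • m = 0
          simp [hP, hij.symm]
        · simp }
  let Φ : M ≃ₗ[k] GradedSpace k d :=
    Φ₀.trans (LinearEquiv.piCongrRight fun i => (Module.finBasis k _).equivFun)
  have hΦ (i : Fin n) (m : M) : Φ (e i • m) = Pi.single i (Φ m i) := by
    ext1 j
    have h1 (m : M) : Φ m j = (Module.finBasis k (LinearMap.range (P j))).equivFun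
      ((P j).rangeRestrict m) := rfl
    have h2 : (P j).rangeRestrict (e i • m) = if j = i then (P j).rangeRestrict m else 0 := by
      ext
      change e j • e i • m = _
      rw [hP]
      split_ifs with h
      · subst h; rfl
      · rfl
    rw [h1, h2]
    split_ifs with h
    · subst h
      simp [h1]
    · simp [h]
  refine ⟨d, ⟨(Φ.conjAlgEquiv k).toAlgHom.comp (Algebra.lsmul k k M), fun i => ?_⟩,
    ⟨{ Φ with map_smul' := fun a m => ?_ }⟩, ?_⟩
  · refine LinearMap.ext fun w => ?_
    obtain ⟨m, rfl⟩ := Φ.surjective w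
    change Φ (e i • Φ.symm (Φ m)) = Pi.single i (Φ m i)
    rw [Φ.symm_apply_apply, hΦ]
  · change Φ (a • m) = Φ (a • Φ.symm (Φ m))
    rw [Φ.symm_apply_apply]
  · rw [Φ.finrank_eq]
    simp [GradedSpace, Module.finrank_pi_fintype]

end Modules

end RepVariety

/-! ### Bricks -/

section Bricks

attribute [local instance] ModuleCat.moduleOfAlgebraModule
  ModuleCat.isScalarTower_of_algebra_moduleCat

variable {k : Type u} [Field k] {A : Type v} [Ring A] [Algebra k A]

theorem IsBrick.exists_algebraMap_smul {M : ModuleCat.{u} A} (hM : IsBrick k A M) (f : M →ₗ[A] M) :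
    ∃ c : k, ∀ v, f v = algebraMap k A c • v := by
  obtain ⟨-, ⟨φ⟩⟩ := hM
  refine ⟨φ f, fun v => ?_⟩
  have : f = algebraMap k (Module.End A M) (φ f) := φ.injective (by simp)
  conv_lhs => rw [this]
  rfl

theorem IsBrick.nontrivial {M : ModuleCat.{u} A} (hM : IsBrick k A M) : Nontrivial M := by
  obtain ⟨-, ⟨φ⟩⟩ := hM
  by_contra h
  rw [not_nontrivial_iff_subsingleton] at h
  have : (1 : Module.End A M) = 0 := Subsingleton.elim _ _
  simpa using congrArg φ this

/-- For an eigenvalue `c` of `f`, the endomorphism `f - c` kills an eigenvector, so it is not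
injective and must vanish. -/
theorem IsBrick.of_injective [IsAlgClosed k] [Module.Finite k A] {M : ModuleCat.{u} A}
    [Module.Finite A M] [Nontrivial M]
    (h : ∀ f : M →ₗ[A] M, f ≠ 0 → Function.Injective f) : IsBrick k A M := by
  have : Module.Finite k M := Module.Finite.trans A M
  refine ⟨inferInstance, ⟨(AlgEquiv.ofBijective (Algebra.ofId k (Module.End A M))
    ⟨FaithfulSMul.algebraMap_injective _ _, fun f => ?_⟩).symm⟩⟩
  obtain ⟨c, hc⟩ := Module.End.exists_eigenvalue (f.restrictScalars k : Module.End k M)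
  obtain ⟨v, hv⟩ := hc.exists_hasEigenvector
  refine ⟨c, ?_⟩
  by_contra hne
  refine hv.2 (h (f - algebraMap k (Module.End A M) c) (sub_ne_zero.2 (Ne.symm hne)) ?_)
  have h1 : f v = c • v := hv.apply_eq_smul
  have h2 : algebraMap k (Module.End A M) c v = c • v := rfl
  rw [LinearMap.sub_apply, h1, h2, sub_self, map_zero]

/-- Every nonzero finite-dimensional module has a brick that is both a quotient and a
submodule of it, namely the image of an endomorphism with minimal nonzero image. -/
theorem exists_isBrick_quotient_submodule [IsAlgClosed k] [Module.Finite k A]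
    (M : ModuleCat.{u} A) [Module.Finite A M] [Nontrivial M] :
    ∃ J : ModuleCat.{u} A, IsBrick k A J ∧ (∃ f : J →ₗ[A] M, Function.Injective f) ∧
      ∃ g : M →ₗ[A] J, Function.Surjective g := by
  have : Module.Finite k M := Module.Finite.trans A M
  have hart : IsArtinian A M := isArtinian_of_tower k inferInstance
  have hnoe : IsNoetherian A M := isNoetherian_of_tower k inferInstance
  obtain ⟨_, ⟨f, hf, rfl⟩, hmin⟩ := IsArtinian.set_has_minimal
    {I : Submodule A M | ∃ f : M →ₗ[A] M, f ≠ 0 ∧ LinearMap.range f = I}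
    ⟨_, LinearMap.id, fun h => by
      obtain ⟨v, hv⟩ := exists_ne (0 : M)
      exact hv (LinearMap.congr_fun h v), rfl⟩
  have hnt : Nontrivial (LinearMap.range f) := by
    rw [Submodule.nontrivial_iff_ne_bot, Ne, LinearMap.range_eq_bot]
    exact hf
  refine ⟨ModuleCat.of A (LinearMap.range f), ?_, ⟨(LinearMap.range f).subtype,
    Subtype.val_injective⟩, f.rangeRestrict, f.surjective_rangeRestrict⟩
  have : Module.Finite A (ModuleCat.of A (LinearMap.range f)) :=
    inferInstanceAs (Module.Finite A (LinearMap.range f))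
  have : Nontrivial (ModuleCat.of A (LinearMap.range f)) := hnt
  refine IsBrick.of_injective fun (g : LinearMap.range f →ₗ[A] LinearMap.range f) hg => ?_
  refine IsNoetherian.injective_of_surjective_endomorphism g ?_
  -- Viewed as an endomorphism of `M`, `g` has nonzero image inside `range f`; minimality forces
  -- equality, so `g` is surjective.
  let h : M →ₗ[A] M := (LinearMap.range f).subtype ∘ₗ g ∘ₗ f.rangeRestrict
  have hle : LinearMap.range h ≤ LinearMap.range f := by
    rintro _ ⟨v, rfl⟩
    exact (g (f.rangeRestrict v)).2
  have hne : h ≠ 0 := fun h0 => hg <| LinearMap.ext fun w => by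
    obtain ⟨v, rfl⟩ := f.surjective_rangeRestrict w
    exact Subtype.ext (LinearMap.congr_fun h0 v)
  have heq : LinearMap.range h = LinearMap.range f :=
    eq_of_le_of_not_lt hle (hmin _ ⟨h, hne, rfl⟩)
  intro w
  obtain ⟨v, hv⟩ : (w : M) ∈ LinearMap.range h := by
    rw [heq]
    exact w.2
  exact ⟨f.rangeRestrict v, Subtype.ext hv⟩

theorem moduleClass_eq_iff {M N : ModuleCat.{u} A} :
    (Quotient.mk (CategoryTheory.isIsomorphicSetoid _) M =
      Quotient.mk (CategoryTheory.isIsomorphicSetoid _) N) ↔ Nonempty (M ≃ₗ[A] N) :=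
  Quotient.eq.trans ⟨fun ⟨i⟩ => ⟨i.toLinearEquiv⟩, fun ⟨i⟩ => ⟨i.toModuleIso⟩⟩

theorem IsBrick.of_linearEquiv {M N : ModuleCat.{u} A} (hM : IsBrick k A M) (f : M ≃ₗ[A] N) :
    IsBrick k A N := by
  obtain ⟨h, ⟨φ⟩⟩ := hM
  exact ⟨Module.Finite.equiv f, ⟨(f.symm.conjAlgEquiv k).trans φ⟩⟩

theorem finrank_le_of_injective_mod {n : ℕ} {e : Fin n → A} {d : Fin n → ℕ}
    {J : ModuleCat.{u} A} {x : RepVariety k A e d}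
    {f : J →ₗ[A] x.Mod} (hf : Function.Injective f) : Module.finrank k J ≤ ∑ i, d i := by
  have h := LinearMap.finrank_le_finrank_of_injective (f := f.restrictScalars k) hf
  have h2 : Module.finrank k x.Mod = Module.finrank k (GradedSpace k d) := rfl
  rw [h2] at h
  simpa [GradedSpace, Module.finrank_pi_fintype] using h

end Bricks

/-! ### Vanishing of `Hom` on irreducible sets -/

namespace RepVariety

variable {k : Type u} [Field k] {A : Type v} [Ring A] [Algebra k A] {n : ℕ}
  {e : Fin n → A} {d : Fin n → ℕ}

theorem id_mem_intertwiners (x : RepVariety k A e d) : LinearMap.id ∈ intertwiners x.hom x.hom :=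
  mem_intertwiners.2 fun _ _ => rfl

theorem nontrivial_gradedSpace (k : Type u) [Field k] (hd : d ≠ 0) :
    Nontrivial (GradedSpace k d) := by
  obtain ⟨i, hi⟩ := Function.ne_iff.1 hd
  have : Nonempty (Fin (d i)) := ⟨⟨0, Nat.pos_of_ne_zero hi⟩⟩
  exact Pi.nontrivial_at i

theorem intertwiners_ne_bot_of_mem_orbit (hd : d ≠ 0) {m x y : RepVariety k A e d}
    (hx : x ∈ m.orbit) (hy : y ∈ m.orbit) : intertwiners x.hom y.hom ≠ ⊥ := by
  have := nontrivial_gradedSpace k hd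
  obtain ⟨g, hg⟩ := hx
  obtain ⟨g', hg'⟩ := hy
  rw [Submodule.ne_bot_iff]
  refine ⟨((LinearEquiv.piCongrRight g).symm.trans (LinearEquiv.piCongrRight g')).toLinearMap,
    mem_intertwiners.2 fun a v => ?_, fun h => ?_⟩
  · simp only [hg, hg', LinearEquiv.conj_apply, LinearMap.comp_apply, LinearEquiv.coe_coe,
      LinearEquiv.trans_apply, LinearEquiv.symm_apply_apply]
  · obtain ⟨v, hv⟩ := exists_ne (0 : GradedSpace k d)
    exact hv ((LinearEquiv.map_eq_zero_iff _).1 (LinearMap.congr_fun h v))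

variable [Module.Finite k A]

theorem exists_isOpen_intertwiners_right_eq_bot {x y : RepVariety k A e d}
    (h : intertwiners x.hom y.hom = ⊥) :
    ∃ U, IsOpen U ∧ y ∈ U ∧ ∀ z ∈ U, intertwiners x.hom z.hom = ⊥ :=
  exists_isOpen_ker_eq_bot (isRegular_commutatorMap_right x.hom) h

theorem exists_isOpen_intertwiners_left_eq_bot {x y : RepVariety k A e d}
    (h : intertwiners x.hom y.hom = ⊥) :
    ∃ U, IsOpen U ∧ x ∈ U ∧ ∀ z ∈ U, intertwiners z.hom y.hom = ⊥ :=
  exists_isOpen_ker_eq_bot (isRegular_commutatorMap_left y.hom) h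

theorem intertwiners_ne_bot_of_hasDenseOrbit (hd : d ≠ 0) {Z : Set (RepVariety k A e d)}
    (hZ : HasDenseOrbit Z) {x y : RepVariety k A e d} (hx : x ∈ Z) (hy : y ∈ Z) :
    intertwiners x.hom y.hom ≠ ⊥ := by
  intro h
  obtain ⟨m, -, rfl⟩ := hZ
  obtain ⟨U, hU, hyU, hU'⟩ := exists_isOpen_intertwiners_right_eq_bot h
  obtain ⟨y', hy'U, hy'⟩ := mem_closure_iff.1 hy U hU hyU
  obtain ⟨V, hV, hxV, hV'⟩ := exists_isOpen_intertwiners_left_eq_bot (hU' y' hy'U)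
  obtain ⟨x', hx'V, hx'⟩ := mem_closure_iff.1 hx V hV hxV
  exact intertwiners_ne_bot_of_mem_orbit hd hx' hy' (hV' x' hx'V)

/-- If some `Hom` vanishes on an irreducible set, then it contains an orthogonal pair. -/
theorem exists_orthogonal {Z : Set (RepVariety k A e d)} (hZ : IsPreirreducible Z)
    {x y : RepVariety k A e d} (hx : x ∈ Z) (hy : y ∈ Z) (h : intertwiners x.hom y.hom = ⊥) :
    ∃ p ∈ Z, ∃ q ∈ Z, intertwiners p.hom q.hom = ⊥ ∧ intertwiners q.hom p.hom = ⊥ := by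
  obtain ⟨U, hU, hyU, hU'⟩ := exists_isOpen_intertwiners_right_eq_bot h
  obtain ⟨V, hV, hxV, hV'⟩ := exists_isOpen_intertwiners_left_eq_bot h
  -- A generic `p` has `Hom(x, p) = 0 = Hom(p, y)`. Both conditions are open in the outer variable,
  -- so one `q` can replace both `x` and `y`.
  obtain ⟨p, hp, hpU, hpV⟩ := hZ U V hU hV ⟨y, hy, hyU⟩ ⟨x, hx, hxV⟩
  obtain ⟨U₁, hU₁, hyU₁, hU₁'⟩ := exists_isOpen_intertwiners_right_eq_bot (hV' p hpV)
  obtain ⟨V₁, hV₁, hxV₁, hV₁'⟩ := exists_isOpen_intertwiners_left_eq_bot (hU' p hpU)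
  obtain ⟨q, hq, hqU, hqV⟩ := hZ U₁ V₁ hU₁ hV₁ ⟨y, hy, hyU₁⟩ ⟨x, hx, hxV₁⟩
  exact ⟨p, hp, q, hq, hU₁' q hqU, hV₁' q hqV⟩

/-- A brick in an irreducible set on which no `Hom` vanishes is isomorphic to all points in a
neighbourhood. -/
theorem exists_isOpen_linearEquiv {Z : Set (RepVariety k A e d)}
    (hZ : ∀ x ∈ Z, ∀ y ∈ Z, intertwiners x.hom y.hom ≠ ⊥) {x : RepVariety k A e d} (hx : x ∈ Z)
    (hbrick : ∀ f : x.Mod →ₗ[A] x.Mod, ∃ c : k, ∀ v, f v = algebraMap k A c • v) :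
    ∃ U, IsOpen U ∧ x ∈ U ∧ ∀ y ∈ Z ∩ U, Nonempty (x.Mod ≃ₗ[A] y.Mod) := by
  obtain ⟨U, hU, hxU, h⟩ := exists_isOpen_injective_intertwiner (id_mem_intertwiners x)
    Function.injective_id
  refine ⟨U, hU, hxU, fun y hy => ?_⟩
  obtain ⟨g, hg, hginj⟩ := h y hy.2 (by
    have h1 : 1 ≤ Module.finrank k (intertwiners x.hom y.hom) :=
      Submodule.one_le_finrank_iff.2 (hZ x hx y hy.1)
    refine le_trans (finrank_le_one ⟨_, id_mem_intertwiners x⟩ fun f => ?_) h1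
    obtain ⟨c, hc⟩ :=
      hbrick ((homEquivIntertwiners (k := k) (M := x.Mod) (N := x.Mod)).symm f)
    exact ⟨c, Subtype.ext (LinearMap.ext fun v =>
      ((hc v).trans (algebraMap_smul (M := x.Mod) A c v)).symm)⟩)
  exact ⟨LinearEquiv.ofBijective
    ((homEquivIntertwiners (k := k) (M := x.Mod) (N := y.Mod)).symm ⟨g, hg⟩)
    ⟨hginj, LinearMap.injective_iff_surjective.1 hginj⟩⟩

/-- If a dense set of points in `Z` admits an injective intertwiner from `ρ`, then so does a
nonempty open subset of `Z`. -/
theorem exists_isOpen_forall_injective {E : Type*} [AddCommGroup E] [Module k E]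
    [Module.Finite k E] (ρ : A →ₐ[k] Module.End k E) {Z : Set (RepVariety k A e d)}
    (hne : Z.Nonempty)
    (hZ : ∀ U, IsOpen U → (Z ∩ U).Nonempty →
      ∃ x ∈ Z ∩ U, ∃ f ∈ intertwiners ρ x.hom, Function.Injective f) :
    ∃ U, IsOpen U ∧ (Z ∩ U).Nonempty ∧
      ∀ y ∈ Z ∩ U, ∃ f ∈ intertwiners ρ y.hom, Function.Injective f := by
  -- Near `x₀` the dimension of `Hom(ρ, -)` on `Z` is minimal. A point of the dense set found there
  -- has the minimal value, so the dimension cannot drop elsewhere on `Z`.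
  obtain ⟨x₀, hx₀, hmin⟩ := exists_minimalFor_of_wellFoundedLT (· ∈ Z)
    (fun x => Module.finrank k (intertwiners ρ x.hom)) hne
  obtain ⟨U, hU, hxU, hle⟩ :=
    exists_isOpen_finrank_ker_le (isRegular_commutatorMap_right (e := e) (d := d) ρ) x₀
  obtain ⟨x, hx, f, hf, hfi⟩ := hZ U hU ⟨x₀, hx₀, hxU⟩
  obtain ⟨V, hV, hxV, h⟩ := exists_isOpen_injective_intertwiner hf hfi
  exact ⟨V, hV, ⟨x, hx.1, hxV⟩, fun y hy => h y hy.2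
    ((hle x hx.2).trans (le_of_not_gt fun hlt => hlt.not_ge (hmin hy.1 hlt.le)))⟩

/-- If a dense set of points in `Z` admits a surjective intertwiner to `σ`, then so does a
nonempty open subset of `Z`. -/
theorem exists_isOpen_forall_surjective {F : Type*} [AddCommGroup F] [Module k F]
    [Module.Finite k F] (σ : A →ₐ[k] Module.End k F) {Z : Set (RepVariety k A e d)}
    (hne : Z.Nonempty)
    (hZ : ∀ U, IsOpen U → (Z ∩ U).Nonempty →
      ∃ x ∈ Z ∩ U, ∃ f ∈ intertwiners x.hom σ, Function.Surjective f) :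
    ∃ U, IsOpen U ∧ (Z ∩ U).Nonempty ∧
      ∀ y ∈ Z ∩ U, ∃ f ∈ intertwiners y.hom σ, Function.Surjective f := by
  obtain ⟨x₀, hx₀, hmin⟩ := exists_minimalFor_of_wellFoundedLT (· ∈ Z)
    (fun x => Module.finrank k (intertwiners x.hom σ)) hne
  obtain ⟨U, hU, hxU, hle⟩ :=
    exists_isOpen_finrank_ker_le (isRegular_commutatorMap_left (e := e) (d := d) σ) x₀
  obtain ⟨x, hx, f, hf, hfi⟩ := hZ U hU ⟨x₀, hx₀, hxU⟩
  obtain ⟨V, hV, hxV, h⟩ := exists_isOpen_surjective_intertwiner hf hfi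
  exact ⟨V, hV, ⟨x, hx.1, hxV⟩, fun y hy => h y hy.2
    ((hle x hx.2).trans (le_of_not_gt fun hlt => hlt.not_ge (hmin hy.1 hlt.le)))⟩

/-- A fixed nonzero module cannot be both a quotient and a submodule of the points in a dense
subset of an irreducible set containing two points with vanishing `Hom`. -/
theorem not_dense_quotient_submodule {E : Type*} [AddCommGroup E] [Module k E]
    [Module.Finite k E] [Nontrivial E] (ρ : A →ₐ[k] Module.End k E)
    {Z : Set (RepVariety k A e d)} (hZ : IsPreirreducible Z) {x y : RepVariety k A e d}
    (hx : x ∈ Z) (hy : y ∈ Z) (h : intertwiners x.hom y.hom = ⊥) :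
    ∃ U, IsOpen U ∧ (Z ∩ U).Nonempty ∧ ∀ z ∈ Z ∩ U,
      ¬ ((∃ f ∈ intertwiners ρ z.hom, Function.Injective f) ∧
        ∃ f ∈ intertwiners z.hom ρ, Function.Surjective f) := by
  by_contra! hdense
  obtain ⟨U, hU, hUne, hU'⟩ := exists_isOpen_forall_injective ρ ⟨x, hx⟩ fun U hU hne =>
    (hdense U hU hne).imp fun _ hz => ⟨hz.1, hz.2.1⟩
  obtain ⟨V, hV, hVne, hV'⟩ := exists_isOpen_forall_surjective ρ ⟨x, hx⟩ fun U hU hne =>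
    (hdense U hU hne).imp fun _ hz => ⟨hz.1, hz.2.2⟩
  obtain ⟨U₁, hU₁, hyU₁, hU₁'⟩ := exists_isOpen_intertwiners_right_eq_bot h
  obtain ⟨y', hy', hy'U, hy'U₁⟩ := hZ U U₁ hU hU₁ hUne ⟨y, hy, hyU₁⟩
  obtain ⟨V₁, hV₁, hxV₁, hV₁'⟩ := exists_isOpen_intertwiners_left_eq_bot (hU₁' y' hy'U₁)
  obtain ⟨x', hx', hx'V, hx'V₁⟩ := hZ V V₁ hV hV₁ hVne ⟨x, hx, hxV₁⟩
  obtain ⟨f, hf, hfi⟩ := hU' y' ⟨hy', hy'U⟩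
  obtain ⟨g, hg, hgs⟩ := hV' x' ⟨hx', hx'V⟩
  -- The composite `x' → E → y'` is a surjection followed by an injection through a nonzero space.
  have h0 : f ∘ₗ g = 0 := (Submodule.eq_bot_iff _).1 (hV₁' x' hx'V₁) _ <|
    mem_intertwiners.2 fun a v => by
      simp [mem_intertwiners.1 hf, mem_intertwiners.1 hg]
  obtain ⟨w, hw⟩ := exists_ne (0 : E)
  obtain ⟨v, rfl⟩ := hgs w
  exact hw (hfi (by simpa using LinearMap.congr_fun h0 v))

end RepVariety

/-! ### Orthogonal pairs and infinite families of bricks -/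

theorem IsPreirreducible.exists_inter_biInter_nonempty {X ι : Type*} [TopologicalSpace X]
    {Z : Set X} (hZ : IsPreirreducible Z) (hne : Z.Nonempty) {S : Set ι} (hS : S.Finite)
    {U : ι → Set X} (hU : ∀ i, IsOpen (U i)) (h : ∀ i, (Z ∩ U i).Nonempty) :
    (Z ∩ ⋂ i ∈ S, U i).Nonempty := by
  induction S, hS using Set.Finite.induction_on with
  | empty => simpa using hne
  | @insert i S _ hS ih =>
    rw [Set.biInter_insert]
    exact hZ _ _ (hU i) (hS.isOpen_biInter fun i _ => hU i) (h i) ih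

section Bricks

open RepVariety CategoryTheory

attribute [local instance] ModuleCat.moduleOfAlgebraModule
  ModuleCat.isScalarTower_of_algebra_moduleCat

variable {k : Type u} [Field k] {A : Type v} [Ring A] [Algebra k A] [Module.Finite k A] {n : ℕ}
  {e : Fin n → A} {d : Fin n → ℕ}

/-- An irreducible set containing two points with vanishing `Hom` forces the existence of
infinitely many bricks of the same dimension. -/
theorem exists_brickClassesOfDim_infinite [IsAlgClosed k] {Z : Set (RepVariety k A e d)}
    (hd : d ≠ 0) (hZ : IsPreirreducible Z) {x y : RepVariety k A e d} (hx : x ∈ Z) (hy : y ∈ Z)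
    (h : intertwiners x.hom y.hom = ⊥) : ∃ m : ℕ, (brickClassesOfDim k A m).Infinite := by
  by_contra! hfin
  -- A brick embedded in a point of `rep(A, d)` has dimension at most `∑ i, d i`.
  let S := ⋃ m ∈ Set.Iic (∑ i, d i), brickClassesOfDim k A m
  have hS : S.Finite := (Set.finite_Iic _).biUnion fun m _ => hfin m
  let Q (J : ModuleCat.{u} A) (z : RepVariety k A e d) : Prop :=
    (∃ f : J →ₗ[A] z.Mod, Function.Injective f) ∧ ∃ g : z.Mod →ₗ[A] J, Function.Surjective g
  have key (J : ModuleCat.{u} A) : ∃ U, IsOpen U ∧ (Z ∩ U).Nonempty ∧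
      (IsBrick k A J → ∀ z ∈ Z ∩ U, ¬ Q J z) := by
    by_cases hJ : IsBrick k A J
    · have := hJ.nontrivial
      have := hJ.1
      have : Module.Finite k J := Module.Finite.trans A J
      obtain ⟨U, hU, hne, hU'⟩ :=
        not_dense_quotient_submodule (Algebra.lsmul k k J : A →ₐ[k] _) hZ hx hy h
      refine ⟨U, hU, hne, fun _ z hz hQ => hU' z hz ?_⟩
      obtain ⟨⟨f, hf⟩, g, hg⟩ := hQ
      exact ⟨⟨(homEquivIntertwiners (k := k) f).1, (homEquivIntertwiners (k := k) f).2, hf⟩,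
        ⟨(homEquivIntertwiners (k := k) g).1, (homEquivIntertwiners (k := k) g).2, hg⟩⟩
    · exact ⟨Set.univ, isOpen_univ, ⟨x, hx, trivial⟩, fun hJ' => absurd hJ' hJ⟩
  choose U hU hne hU' using key
  -- This `z` avoids having any of the finitely many candidate bricks as both submodule and
  -- quotient, yet some brick must play both roles.
  obtain ⟨z, hz, hzU⟩ := hZ.exists_inter_biInter_nonempty ⟨x, hx⟩ hS
    (U := fun c => U c.out) (fun _ => hU _) (fun _ => hne _)
  have : Nontrivial (ModuleCat.of A z.Mod) := nontrivial_gradedSpace k hd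
  have hfinite : Module.Finite A z.Mod := Module.Finite.of_restrictScalars_finite k A z.Mod
  have : Module.Finite A (ModuleCat.of A z.Mod) := hfinite
  obtain ⟨J, hJ, ⟨f, hf⟩, g, hg⟩ :=
    exists_isBrick_quotient_submodule (k := k) (ModuleCat.of A z.Mod)
  let c : Quotient (isIsomorphicSetoid (ModuleCat.{u} A)) := Quotient.mk _ J
  have hc : c ∈ S := Set.mem_biUnion (Set.mem_Iic.2 (finrank_le_of_injective_mod hf))
    ⟨J, hJ, rfl, rfl⟩
  obtain ⟨φ⟩ : Nonempty (J ≃ₗ[A] c.out) := moduleClass_eq_iff.1 (Quotient.out_eq c).symm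
  exact hU' c.out (hJ.of_linearEquiv φ) z ⟨hz, Set.mem_iInter₂.1 hzU c hc⟩
    ⟨⟨(f : J →ₗ[A] z.Mod) ∘ₗ φ.symm.toLinearMap, hf.comp φ.symm.injective⟩,
      φ.toLinearMap ∘ₗ (g : z.Mod →ₗ[A] J), φ.surjective.comp hg⟩

/-- Infinitely many bricks of the same dimension force an irreducible component containing two
points with vanishing `Hom`. -/
theorem exists_intertwiners_eq_bot_of_infinite (he : CompleteOrthogonalIdempotents e) {m : ℕ}
    (hm : (brickClassesOfDim k A m).Infinite) :
    ∃ d : Fin n → ℕ, d ≠ 0 ∧ ∃ Z ∈ irreducibleComponents (RepVariety k A e d),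
      ∃ x ∈ Z, ∃ y ∈ Z, intertwiners x.hom y.hom = ⊥ := by
  by_contra! hcon
  let C (d : Fin n → ℕ) (Z : Set (RepVariety k A e d)) :
      Set (Quotient (isIsomorphicSetoid (ModuleCat.{u} A))) :=
    {c | ∃ x ∈ Z, IsBrick k A (ModuleCat.of A x.Mod) ∧
      Quotient.mk _ (ModuleCat.of A x.Mod) = c}
  -- An `m`-dimensional brick has `d ≤ m` entrywise. Each component holds at most one brick class:
  -- neighbourhoods of two bricks meet in `Z`, at a point isomorphic to both.
  refine hm (Set.Finite.subset (s := ⋃ d ∈ Set.Iic (fun _ : Fin n => m) ∩ {0}ᶜ,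
    ⋃ Z ∈ irreducibleComponents (RepVariety k A e d), C d Z) ?_ ?_)
  · refine ((Set.finite_Iic _).inter_of_left _).biUnion fun d hd =>
      TopologicalSpace.NoetherianSpace.finite_irreducibleComponents.biUnion fun Z hZ =>
        Set.Subsingleton.finite ?_
    rintro _ ⟨x, hx, hxb, rfl⟩ _ ⟨y, hy, hyb, rfl⟩
    obtain ⟨U, hU, hxU, hU'⟩ := exists_isOpen_linearEquiv (hcon d hd.2 Z hZ) hx
      fun f => hxb.exists_algebraMap_smul f
    obtain ⟨V, hV, hyV, hV'⟩ := exists_isOpen_linearEquiv (hcon d hd.2 Z hZ) hy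
      fun f => hyb.exists_algebraMap_smul f
    obtain ⟨z, hz, hzU, hzV⟩ := hZ.1.2 U V hU hV ⟨x, hx, hxU⟩ ⟨y, hy, hyV⟩
    obtain ⟨φ⟩ := hU' z ⟨hz, hzU⟩
    obtain ⟨ψ⟩ := hV' z ⟨hz, hzV⟩
    exact moduleClass_eq_iff.2 ⟨φ.trans ψ.symm⟩
  · rintro _ ⟨M, hM, rfl, rfl⟩
    have := hM.1
    have := hM.nontrivial
    have : Module.Finite k M := Module.Finite.trans A M
    obtain ⟨d, x, ⟨φ⟩, hd⟩ := exists_point (k := k) (M := M) he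
    refine Set.mem_biUnion (x := d) ⟨fun i => ?_, ?_⟩
      (Set.mem_biUnion (irreducibleComponent_mem_irreducibleComponents x)
        ⟨x, mem_irreducibleComponent, hM.of_linearEquiv φ, moduleClass_eq_iff.2 ⟨φ.symm⟩⟩)
    · rw [← hd]
      exact Finset.single_le_sum (f := d) (fun _ _ => Nat.zero_le _) (Finset.mem_univ i)
    · rintro rfl
      have := Module.finrank_pos (R := k) (M := M)
      simp [← hd] at this

end Bricks

end

theorem theoremB {k : Type u} [Field k] [IsAlgClosed k] {A : Type v} [Ring A] [Algebra k A]
    [Module.Finite k A] {n : ℕ} (e : Fin n → A) (he : CompleteOrthogonalIdempotents e) :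
    -- a component with a dense orbit contains no pair with vanishing Hom
    (∀ d : Fin n → ℕ, d ≠ 0 → ∀ Z ∈ irreducibleComponents (RepVariety k A e d),
      RepVariety.HasDenseOrbit Z → ∀ X ∈ Z, ∀ Y ∈ Z, ∃ f : X.Mod →ₗ[A] Y.Mod, f ≠ 0) ∧
    -- orthogonal orbits in a component vs infinitely many bricks of one dimension
    ((∃ d : Fin n → ℕ, d ≠ 0 ∧ ∃ Z ∈ irreducibleComponents (RepVariety k A e d),
        ∃ X ∈ Z, ∃ Y ∈ Z, RepVariety.HomOrthogonal X Y) ↔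
      ∃ m : ℕ, (brickClassesOfDim k A m).Infinite) ∧
    -- the brick-finite case
    (BrickFinite k A →
      ∀ d : Fin n → ℕ, d ≠ 0 → ∀ Z ∈ irreducibleComponents (RepVariety k A e d),
        ∀ X ∈ Z, ∀ Y ∈ Z, ∃ f : X.Mod →ₗ[A] Y.Mod, f ≠ 0) := by
  simp only [RepVariety.exists_ne_zero_iff_intertwiners_ne_bot, RepVariety.homOrthogonal_iff]
  refine ⟨fun d hd Z _ hO X hX Y hY => RepVariety.intertwiners_ne_bot_of_hasDenseOrbit hd hO hX hY,
    ⟨?_, ?_⟩, fun hfin d hd Z hZ X hX Y hY h => ?_⟩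
  · rintro ⟨d, hd, Z, hZ, X, hX, Y, hY, h, -⟩
    exact exists_brickClassesOfDim_infinite hd hZ.1.2 hX hY h
  · rintro ⟨m, hm⟩
    obtain ⟨d, hd, Z, hZ, X, hX, Y, hY, h⟩ := exists_intertwiners_eq_bot_of_infinite he hm
    exact ⟨d, hd, Z, hZ, RepVariety.exists_orthogonal hZ.1.2 hX hY h⟩
  · obtain ⟨m, hm⟩ := exists_brickClassesOfDim_infinite hd hZ.1.2 hX hY h
    refine hm (hfin.subset ?_)
    rintro _ ⟨M, hM, -, rfl⟩
    exact ⟨M, hM, rfl⟩
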